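/- For a bounded potential $U:\mathbb{Z}\to\mathbb{R}$ let $\Delta+U$ be the bounded self-adjoint operator on $\ell^2(\mathbb{Z})$ given by $$((\Delta+U)\psi)(n)=\psi(n-1)+\psi(n+1)+U(n)\psi(n).$$ For $H=\Delta+U$, $p>0$ and $T>0$ put $$a(n,T)=\frac1T\int_0^{\infty}e^{-2t/T}\,|\langle\delta_n,e^{-itH}\delta_1\rangle|^2\,dt,\qquad \langle|X|^p_{\delta_1}\rangle(T)=\sum_{n\in\mathbb{Z}}|n|^p\,a(n,T),$$ $$\beta^-_{\delta_1}(p)=\liminf_{T\to+\infty}\frac{\log\langle|X|^p_{\delta_1}\rangle(T)}{\log T}.$$ For $V:\mathbb{Z}\to\mathbb{R}$, $E\in\mathbb{R}$ and $n,m\in\mathbb{Z}$ let $T(n,m;E)$ be the transfer matrix of $\Delta+V$, that is, the $2\times2$ matrix with $$(\varphi(n+1),\varphi(n))^T=T(n,m;E)\,(\varphi(m+1),\varphi(m))^T$$ for every solution $\varphi$ of $\varphi(k+1)+\varphi(k-1)+V(k)\varphi(k)=E\varphi(k)$, $k\in\mathbb{Z}$, and let $\|\cdot\|$ be the operator norm.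 Corollary 3.2. Let $V,W:\mathbb{Z}\to\mathbb{R}$ and $E_0,\alpha,C_1,C_2,\varepsilon\in\mathbb{R}$ with $\varepsilon>0$. Suppose that $$\|T(n,m;E_0)\|\le C_1|n-m|^{\alpha}\quad\text{for all } n,m\in\mathbb{Z} \text{ with } n\ne m \text{ and } nm\ge0,$$ and that $$|W(n)|\le C_2|n|^{-1-2\alpha-\varepsilon}\quad\text{for all } n\in\mathbb{Z}\setminus\{0\}.$$ Then $V+W$ is bounded, and the operator $\Delta+V+W$ satisfies $$\beta^-_{\delta_1}(p)\ge\frac{p-1-4\alpha}{1+\alpha}\quad\text{for every } p>0.$$ -/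

import Mathlib

noncomputable section

namespace Schrodinger1D

/-! ### Transfer matrices -/

/-- The one-step transfer matrix `T(x; E)`. -/
def stepMatrix (E x : ℝ) : Matrix (Fin 2) (Fin 2) ℝ := !![E - x, -1; 1, 0]

/-- `T(V(m+k); E) * ⋯ * T(V(m+1); E)`, the product of `k` one-step matrices. -/
def transferUp (V : ℤ → ℝ) (E : ℝ) (m : ℤ) : ℕ → Matrix (Fin 2) (Fin 2) ℝ
  | 0 => 1
  | k + 1 => stepMatrix E (V (m + (k + 1 : ℕ))) * transferUp V E m k

/-- The transfer matrix `T(n, m; E)` of `Δ + V`. For `n ≥ m` it is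
`T(V(n); E) * ⋯ * T(V(m+1); E)`, and for `n < m` it is the inverse of `T(m, n; E)`
(all the factors have determinant `1`). -/
def transferMatrix (V : ℤ → ℝ) (E : ℝ) (n m : ℤ) : Matrix (Fin 2) (Fin 2) ℝ :=
  if m ≤ n then transferUp V E m (n - m).toNat else (transferUp V E n (m - n).toNat)⁻¹

/-- `φ(n+1) + φ(n-1) + V(n) φ(n) = E φ(n)` for all `n`. -/
def IsSolution (V : ℤ → ℝ) (E : ℝ) (φ : ℤ → ℝ) : Prop :=
  ∀ n, φ (n + 1) + φ (n - 1) + V n * φ n = E * φ n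

theorem det_transferUp (V : ℤ → ℝ) (E : ℝ) (m : ℤ) (k : ℕ) : (transferUp V E m k).det = 1 := by
  induction k with
  | zero => simp [transferUp]
  | succ k ih => rw [transferUp, Matrix.det_mul, ih, stepMatrix]; simp [Matrix.det_fin_two]

theorem transferUp_mulVec {V : ℤ → ℝ} {E : ℝ} {φ : ℤ → ℝ} (h : IsSolution V E φ) (m : ℤ) (k : ℕ) :
    Matrix.mulVec (transferUp V E m k) ![φ (m + 1), φ m] = ![φ (m + k + 1), φ (m + k)] := by
  induction k with
  | zero => simp [transferUp]
  | succ k ih =>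
    have h1 := h (m + k + 1)
    rw [transferUp, ← Matrix.mulVec_mulVec, ih]
    have e1 : m + ((k + 1 : ℕ) : ℤ) = m + k + 1 := by push_cast; ring
    have e2 : m + (k : ℤ) + 1 - 1 = m + k := by ring
    rw [e2] at h1
    rw [e1]
    ext i
    fin_cases i
    · simp [stepMatrix, Matrix.mulVec, dotProduct, Fin.sum_univ_two]; linarith
    · simp [stepMatrix, Matrix.mulVec, dotProduct, Fin.sum_univ_two]

/-- The defining property of the transfer matrix: it maps `Φ(m)` to `Φ(n)`,
where `Φ(n) = (φ(n+1), φ(n))`, for every solution `φ`. -/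
theorem transferMatrix_mulVec {V : ℤ → ℝ} {E : ℝ} {φ : ℤ → ℝ} (h : IsSolution V E φ) (n m : ℤ) :
    Matrix.mulVec (transferMatrix V E n m) ![φ (m + 1), φ m] = ![φ (n + 1), φ n] := by
  unfold transferMatrix
  split_ifs with hmn
  · rw [transferUp_mulVec h, Int.toNat_of_nonneg (by omega)]
    simp
  · have h2 := transferUp_mulVec h n (m - n).toNat
    rw [Int.toNat_of_nonneg (by omega), show n + (m - n) = m by ring] at h2
    rw [← h2, Matrix.mulVec_mulVec, Matrix.nonsing_inv_mul _ (by simp [det_transferUp]),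
      Matrix.one_mulVec]

/-- The operator norm of a `2 × 2` matrix acting on Euclidean `ℝ²`. -/
def opNorm (A : Matrix (Fin 2) (Fin 2) ℝ) : ℝ :=
  ‖Matrix.toEuclideanCLM (n := Fin 2) (𝕜 := ℝ) A‖

/-! ### The operator `Δ + V` on `ℓ²(ℤ)` -/

/-- The Hilbert space `ℓ²(ℤ)` of square-summable complex sequences. -/
abbrev L2Z : Type := lp (fun _ : ℤ => ℂ) 2

/-- The canonical basis vector `δ_n`. -/
def delta (n : ℤ) : L2Z := lp.single 2 n (1 : ℂ)

/-- The translation `(S_k ψ)(n) = ψ(n + k)` on `ℓ²(ℤ)`. -/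
def shift (k : ℤ) : L2Z →L[ℂ] L2Z :=
  LinearMap.mkContinuous
    { toFun := fun ψ => ⟨fun n => ψ (n + k), by
        have h : Summable fun n : ℤ => ‖ψ n‖ ^ (2 : ENNReal).toReal :=
          (lp.memℓp ψ).summable (by simp)
        exact memℓp_gen ((Equiv.addRight k).summable_iff.mpr h)⟩
      map_add' := fun _ _ => rfl
      map_smul' := fun _ _ => rfl }
    1 (fun ψ => by
      rw [one_mul, lp.norm_eq_tsum_rpow (by simp), lp.norm_eq_tsum_rpow (by simp)]
      exact le_of_eq (congrArg (fun x : ℝ => x ^ (1 / (2 : ENNReal).toReal))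
        ((Equiv.addRight k).tsum_eq fun n : ℤ => ‖ψ n‖ ^ (2 : ENNReal).toReal)))

/-- A bounded potential. -/
def IsBddPotential (V : ℤ → ℝ) : Prop := ∃ C : ℝ, ∀ n, |V n| ≤ C

theorem norm_mul_le {V : ℤ → ℝ} {C : ℝ} (hC : ∀ n, |V n| ≤ C) (ψ : L2Z) (n : ℤ) :
    ‖(V n : ℂ) * ψ n‖ ≤ ‖((C : ℂ) • ψ : L2Z) n‖ := by
  have h0 : |V n| ≤ |C| := (hC n).trans (le_abs_self C)
  rw [lp.coeFn_smul, Pi.smul_apply, smul_eq_mul, norm_mul, norm_mul, Complex.norm_real,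
    Complex.norm_real]
  exact mul_le_mul_of_nonneg_right h0 (norm_nonneg (ψ n))

/-- Multiplication by a bounded potential, `(V ψ)(n) = V(n) ψ(n)`, on `ℓ²(ℤ)`. -/
def mulOp (V : ℤ → ℝ) (hV : IsBddPotential V) : L2Z →L[ℂ] L2Z :=
  LinearMap.mkContinuousOfExistsBound
    { toFun := fun ψ => ⟨fun n => (V n : ℂ) * ψ n, by
        obtain ⟨C, hC⟩ := hV
        exact (lp.memℓp ((C : ℂ) • ψ)).mono' (norm_mul_le hC ψ)⟩
      map_add' := fun f g => by ext n; exact mul_add _ _ _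
      map_smul' := fun c f => by ext n; exact mul_left_comm _ _ _ }
    (by
      obtain ⟨C, hC⟩ := hV
      refine ⟨‖(C : ℂ)‖, fun ψ => ?_⟩
      rw [← norm_smul]
      exact lp.norm_mono (by simp) (norm_mul_le hC ψ))

/-- The Schrödinger operator `(H ψ)(n) = ψ(n-1) + ψ(n+1) + V(n) ψ(n)` on `ℓ²(ℤ)`. -/
def schrodingerOp (V : ℤ → ℝ) (hV : IsBddPotential V) : L2Z →L[ℂ] L2Z :=
  shift (-1) + shift 1 + mulOp V hV

theorem schrodingerOp_apply (V : ℤ → ℝ) (hV : IsBddPotential V) (ψ : L2Z) (n : ℤ) :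
    schrodingerOp V hV ψ n = ψ (n - 1) + ψ (n + 1) + (V n : ℂ) * ψ n := rfl

/-! ### Dynamics and growth exponents -/

/-- `exp (-itH) ψ`. -/
def evolve (H : L2Z →L[ℂ] L2Z) (ψ : L2Z) (t : ℝ) : L2Z :=
  NormedSpace.exp ((-(Complex.I * (t : ℂ))) • H) ψ

/-- `a(n, T) = (1/T) ∫₀^∞ exp(-2t/T) |⟨δ_n, exp(-itH) ψ⟩|² dt` -/
def timeAvgProb (H : L2Z →L[ℂ] L2Z) (ψ : L2Z) (n : ℤ) (T : ℝ) : ℝ :=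
  1 / T * ∫ t in Set.Ioi (0 : ℝ), Real.exp (-2 * t / T) * ‖inner ℂ (delta n) (evolve H ψ t)‖ ^ 2

/-- The time-averaged moment `⟨|X|_ψ^p⟩(T) = ∑_n |n|^p a(n, T)`, as a sum of nonnegative terms
with values in `[0, ∞]`. -/
def moment (H : L2Z →L[ℂ] L2Z) (ψ : L2Z) (p T : ℝ) : ENNReal :=
  ∑' n : ℤ, ENNReal.ofReal (|(n : ℝ)| ^ p * timeAvgProb H ψ n T)

/-- The lower growth exponent `β⁻_ψ(p) = liminf_{T → +∞} log ⟨|X|_ψ^p⟩(T) / log T`, taken in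
the extended reals. -/
def betaMinus (H : L2Z →L[ℂ] L2Z) (ψ : L2Z) (p : ℝ) : EReal :=
  Filter.liminf (fun T : ℝ => ENNReal.log (moment H ψ p T) / ((Real.log T : ℝ) : EReal)) Filter.atTop

end Schrodinger1D

end

/-!
The argument looks at a single complex energy `z = E₀ + 2i/T`.

*Dynamics.* Let `u(n) = ∫₀^∞ exp(izt) ⟨δ_n, exp(-itH) δ₁⟩ dt`. The amplitudes are bounded because `H`
is self-adjoint (`norm_evolve_delta_apply_le`), so the integral converges, and an integration by
parts turns Heisenberg's equation into `(H - z) u = -i δ₁` (`laplaceAmplitude_eq`). Cauchy-Schwarz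
for the weight `exp(-2t/T)` gives `a(n, T) ≥ (2/T²) |u(n)|²` (`sq_norm_laplaceAmplitude_le`).

*Transfer matrices.* Away from the site `1`, `u` solves the homogeneous equation for `V + W` at the
energy `z`, a perturbation of the one for `V` at `E₀` by `w(j) = z - E₀ - W(j)`. Pulling `u` back with
the unperturbed transfer matrices and applying a discrete Grönwall inequality costs a factor
`exp(C ∑ |j|^α |w(j)|)` (`norm_right_le`, `norm_left_le`). On `|j| ≤ N` the sum is bounded as long as
`N^(1+α)` is at most of order `T`, by the decay of `W`. Hence `(u(n+1), u(n))` is, up to constants,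
at least `n^(-α)` times its value next to the source, for both signs of `n`. The source forces
one of the two values next to it to be of order one, so `u` is at least of order `n^(-α)` near `n` or
near `-n` (`exists_lower_bound`).

*Moments.* With `N = T^(1/(1+α))`, summing over `n` of order `N` gives
`⟨|X|^p⟩(T) ≥ c N^p · N · T^(-2) N^(-2α) = c T^((p-1-4α)/(1+α))` (`exists_moment_lower_bound`).
Since transfer matrices have determinant one, `α ≥ 0` (`nonneg_exponent`), and `1 + α` is positive.
-/

namespace Schrodinger1D

open MeasureTheory Filter Topology

/-! ### Time evolution -/

theorem inner_delta_left (n : ℤ) (ψ : L2Z) : inner ℂ (delta n) ψ = ψ n := by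
  simp [delta, lp.inner_single_left]

theorem inner_shift_left (k : ℤ) (ψ φ : L2Z) :
    inner ℂ (shift k ψ) φ = inner ℂ ψ (shift (-k) φ) := by
  rw [lp.inner_eq_tsum, lp.inner_eq_tsum,
    ← (Equiv.addRight k).tsum_eq fun n : ℤ => inner ℂ (ψ n) (shift (-k) φ n)]
  refine tsum_congr fun n => ?_
  change inner ℂ (ψ (n + k)) (φ n) = inner ℂ (ψ (n + k)) (φ (n + k + -k))
  rw [add_neg_cancel_right]

theorem inner_mulOp_left (U : ℤ → ℝ) (hU : IsBddPotential U) (ψ φ : L2Z) :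
    inner ℂ (mulOp U hU ψ) φ = inner ℂ ψ (mulOp U hU φ) := by
  rw [lp.inner_eq_tsum, lp.inner_eq_tsum]
  refine tsum_congr fun n => ?_
  change inner ℂ ((U n : ℂ) * ψ n) (φ n) = inner ℂ (ψ n) ((U n : ℂ) * φ n)
  simp only [RCLike.inner_apply, map_mul, Complex.conj_ofReal]
  ring

theorem isSelfAdjoint_schrodingerOp (U : ℤ → ℝ) (hU : IsBddPotential U) :
    IsSelfAdjoint (schrodingerOp U hU) := by
  rw [ContinuousLinearMap.isSelfAdjoint_iff_isSymmetric]
  intro ψ φ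
  change inner ℂ (shift (-1) ψ + shift 1 ψ + mulOp U hU ψ) φ
    = inner ℂ ψ (shift (-1) φ + shift 1 φ + mulOp U hU φ)
  rw [inner_add_left, inner_add_left, inner_add_right, inner_add_right, inner_shift_left,
    inner_shift_left, inner_mulOp_left, neg_neg, add_comm (inner ℂ ψ (shift 1 φ))]

theorem norm_evolve_le {H : L2Z →L[ℂ] L2Z} (hH : IsSelfAdjoint H) (ψ : L2Z) (t : ℝ) :
    ‖evolve H ψ t‖ ≤ ‖ψ‖ := by
  have h : (-(Complex.I * (t : ℂ))) • H ∈ skewAdjoint (L2Z →L[ℂ] L2Z) := by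
    rw [skewAdjoint.mem_iff, star_smul, hH.star_eq]
    simp
  let _ : NormedAlgebra ℚ (L2Z →L[ℂ] L2Z) := NormedAlgebra.restrictScalars ℚ ℂ _
  have h2 := NormedSpace.exp_mem_unitary_of_mem_skewAdjoint h
  exact (ContinuousLinearMap.norm_map_of_mem_unitary h2 ψ).le

theorem norm_evolve_delta_apply_le {H : L2Z →L[ℂ] L2Z} (hH : IsSelfAdjoint H) (m n : ℤ) (t : ℝ) :
    ‖evolve H (delta m) t n‖ ≤ 1 := by
  have h1 : ‖delta m‖ ≤ 1 := by
    rw [delta, lp.norm_single (by simp)]; simp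
  exact (lp.norm_apply_le_norm (by simp) _ n).trans ((norm_evolve_le hH _ t).trans h1)

theorem evolve_zero (H : L2Z →L[ℂ] L2Z) (ψ : L2Z) : evolve H ψ 0 = ψ := by
  simp [evolve, NormedSpace.exp_zero]

theorem hasDerivAt_evolve (H : L2Z →L[ℂ] L2Z) (ψ : L2Z) (t : ℝ) :
    HasDerivAt (evolve H ψ) (-Complex.I • H (evolve H ψ t)) t := by
  have h1 := hasDerivAt_exp_smul_const' (𝕂 := ℝ) ((-Complex.I) • H) t
  have h2 := ((ContinuousLinearMap.apply ℂ L2Z ψ).restrictScalars ℝ).hasFDerivAt.comp_hasDerivAt t h1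
  have e : ∀ s : ℝ, (-(Complex.I * (s : ℂ))) • H = s • ((-Complex.I) • H) := by
    intro s
    ext φ n
    change (-(Complex.I * (s : ℂ))) * H φ n = s • (-Complex.I * H φ n)
    rw [Complex.real_smul]
    ring
  unfold evolve
  simp_rw [e]
  exact h2

/-- Heisenberg's equation in coordinates. -/
theorem hasDerivAt_evolve_apply (U : ℤ → ℝ) (hU : IsBddPotential U) (ψ : L2Z) (n : ℤ) (t : ℝ) :
    HasDerivAt (fun s => evolve (schrodingerOp U hU) ψ s n)
      (-Complex.I * (evolve (schrodingerOp U hU) ψ t (n - 1)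
        + evolve (schrodingerOp U hU) ψ t (n + 1)
        + (U n : ℂ) * evolve (schrodingerOp U hU) ψ t n)) t := by
  have h1 := hasDerivAt_evolve (schrodingerOp U hU) ψ t
  have h2 := ((innerSL ℂ (delta n)).restrictScalars ℝ).hasFDerivAt.comp_hasDerivAt t h1
  have e : ∀ φ : L2Z, ((innerSL ℂ (delta n)).restrictScalars ℝ) φ = φ n := inner_delta_left n
  rw [e] at h2
  exact h2.congr_of_eventuallyEq (Filter.Eventually.of_forall fun s => (e _).symm)

/-! ### The Laplace transform of the evolution -/

/-- The Laplace transform `∫₀^∞ exp(izt) (exp(-itH) ψ)(n) dt` of the `n`-th coordinate of the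
evolution. For `Im z > 0` it equals `-i ((H - z)⁻¹ ψ)(n)`. -/
noncomputable def laplaceAmplitude (H : L2Z →L[ℂ] L2Z) (ψ : L2Z) (z : ℂ) (n : ℤ) : ℂ :=
  ∫ t in Set.Ioi (0 : ℝ), Complex.exp (Complex.I * z * t) * evolve H ψ t n

theorem norm_cexp_I_mul (z : ℂ) (t : ℝ) :
    ‖Complex.exp (Complex.I * z * t)‖ = Real.exp (-z.im * t) := by
  rw [Complex.norm_exp]; simp

theorem continuous_evolve_apply (H : L2Z →L[ℂ] L2Z) (ψ : L2Z) (n : ℤ) :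
    Continuous fun t => evolve H ψ t n := by
  have h : Continuous (evolve H ψ) :=
    continuous_iff_continuousAt.2 fun t => (hasDerivAt_evolve H ψ t).continuousAt
  have h2 := (innerSL ℂ (delta n)).continuous.comp h
  refine h2.congr fun t => inner_delta_left n _

theorem integrableOn_cexp_mul {f : ℝ → ℂ} (hf : Continuous f) (hf1 : ∀ t, ‖f t‖ ≤ 1) {z : ℂ}
    (hz : 0 < z.im) :
    IntegrableOn (fun t : ℝ => Complex.exp (Complex.I * z * t) * f t) (Set.Ioi 0) := by
  refine Integrable.mono' (exp_neg_integrableOn_Ioi 0 hz) ?_ (Eventually.of_forall fun t => ?_)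
  · exact Continuous.aestronglyMeasurable (by fun_prop)
  · rw [norm_mul, norm_cexp_I_mul]
    exact mul_le_of_le_one_right (Real.exp_pos _).le (hf1 t)

/-- The Laplace transform solves the resolvent equation `(H - z) u = -i δ₁`: this is Heisenberg's
equation integrated by parts. -/
theorem laplaceAmplitude_eq (U : ℤ → ℝ) (hU : IsBddPotential U) {z : ℂ} (hz : 0 < z.im) (n : ℤ) :
    laplaceAmplitude (schrodingerOp U hU) (delta 1) z (n - 1)
      + laplaceAmplitude (schrodingerOp U hU) (delta 1) z (n + 1)
      + U n * laplaceAmplitude (schrodingerOp U hU) (delta 1) z n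
    = z * laplaceAmplitude (schrodingerOp U hU) (delta 1) z n
      - Complex.I * delta 1 n := by
  set H := schrodingerOp U hU with hH
  have hsa : IsSelfAdjoint H := isSelfAdjoint_schrodingerOp U hU
  have hint : ∀ m : ℤ, IntegrableOn
      (fun t : ℝ => Complex.exp (Complex.I * z * t) * evolve H (delta 1) t m) (Set.Ioi 0) :=
    fun m => integrableOn_cexp_mul (continuous_evolve_apply H _ m)
      (norm_evolve_delta_apply_le hsa 1 m) hz
  have hderiv : ∀ t : ℝ, HasDerivAt
      (fun t : ℝ => Complex.exp (Complex.I * z * t) * evolve H (delta 1) t n)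
      (Complex.I * z * (Complex.exp (Complex.I * z * t) * evolve H (delta 1) t n)
        - Complex.I * (Complex.exp (Complex.I * z * t) * evolve H (delta 1) t (n - 1)
          + Complex.exp (Complex.I * z * t) * evolve H (delta 1) t (n + 1)
          + U n * (Complex.exp (Complex.I * z * t) * evolve H (delta 1) t n))) t := by
    intro t
    have h1 : HasDerivAt (fun t : ℝ => Complex.exp (Complex.I * z * t))
        (Complex.exp (Complex.I * z * t) * (Complex.I * z)) t := by
      have h0 := ((hasDerivAt_id t).ofReal_comp.const_mul (Complex.I * z)).cexp
      simpa using h0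
    refine (h1.mul (hasDerivAt_evolve_apply U hU (delta 1) n t)).congr_deriv ?_
    rw [← hH]
    ring
  have hlim : Tendsto (fun t : ℝ => Complex.exp (Complex.I * z * t) * evolve H (delta 1) t n)
      atTop (𝓝 0) := by
    refine squeeze_zero_norm (a := fun t : ℝ => Real.exp (-z.im * t)) (fun t => ?_) ?_
    · rw [norm_mul, norm_cexp_I_mul]
      exact mul_le_of_le_one_right (Real.exp_pos _).le (norm_evolve_delta_apply_le hsa 1 n t)
    · exact Real.tendsto_exp_atBot.comp (tendsto_id.const_mul_atTop_of_neg (by linarith))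
  have i1 : IntegrableOn (fun t : ℝ => Complex.exp (Complex.I * z * t) * evolve H (delta 1) t (n - 1)
      + Complex.exp (Complex.I * z * t) * evolve H (delta 1) t (n + 1)) (Set.Ioi 0) :=
    (hint (n - 1)).add (hint (n + 1))
  have i2 : IntegrableOn (fun t : ℝ => Complex.exp (Complex.I * z * t) * evolve H (delta 1) t (n - 1)
      + Complex.exp (Complex.I * z * t) * evolve H (delta 1) t (n + 1)
      + U n * (Complex.exp (Complex.I * z * t) * evolve H (delta 1) t n)) (Set.Ioi 0) :=
    i1.add ((hint n).const_mul _)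
  have hi := integral_Ioi_of_hasDerivAt_of_tendsto (hderiv 0).continuousAt.continuousWithinAt
    (fun t _ => hderiv t) (((hint n).const_mul _).sub (i2.const_mul _)) hlim
  rw [integral_sub ((hint n).const_mul _) (i2.const_mul _),
    integral_const_mul, integral_const_mul, integral_add i1 ((hint n).const_mul _),
    integral_add (hint (n - 1)) (hint (n + 1)), integral_const_mul, evolve_zero] at hi
  simp only [Complex.ofReal_zero, mul_zero, Complex.exp_zero, one_mul, zero_sub] at hi
  unfold laplaceAmplitude
  linear_combination (Complex.I) * hi + (-z * (∫ t in Set.Ioi (0 : ℝ),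
    Complex.exp (Complex.I * z * t) * evolve H (delta 1) t n) + (∫ t in Set.Ioi (0 : ℝ),
    Complex.exp (Complex.I * z * t) * evolve H (delta 1) t (n - 1)) + (∫ t in Set.Ioi (0 : ℝ),
    Complex.exp (Complex.I * z * t) * evolve H (delta 1) t (n + 1)) + U n * (∫ t in Set.Ioi (0 : ℝ),
    Complex.exp (Complex.I * z * t) * evolve H (delta 1) t n)) * Complex.I_sq

/-- Cauchy-Schwarz for the exponential weight. -/
theorem sq_norm_integral_le {f : ℝ → ℂ} (hf : Continuous f) (hf1 : ∀ t, ‖f t‖ ≤ 1) {z : ℂ}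
    (hz : 0 < z.im) :
    ‖∫ t in Set.Ioi (0 : ℝ), Complex.exp (Complex.I * z * t) * f t‖ ^ 2
      ≤ 1 / z.im * ∫ t in Set.Ioi (0 : ℝ), Real.exp (-z.im * t) * ‖f t‖ ^ 2 := by
  set J := ∫ t in Set.Ioi (0 : ℝ), Real.exp (-z.im * t) * ‖f t‖ with hJ
  have i0 := exp_neg_integrableOn_Ioi 0 hz
  have i1 : IntegrableOn (fun t : ℝ => Real.exp (-z.im * t) * ‖f t‖) (Set.Ioi 0) := by
    refine Integrable.mono' i0 (Continuous.aestronglyMeasurable (by fun_prop))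
      (Eventually.of_forall fun t => ?_)
    rw [Real.norm_of_nonneg (by positivity)]
    exact mul_le_of_le_one_right (Real.exp_pos _).le (hf1 t)
  have i2 : IntegrableOn (fun t : ℝ => Real.exp (-z.im * t) * ‖f t‖ ^ 2) (Set.Ioi 0) := by
    refine Integrable.mono' i0 (Continuous.aestronglyMeasurable (by fun_prop))
      (Eventually.of_forall fun t => ?_)
    rw [Real.norm_of_nonneg (by positivity)]
    exact mul_le_of_le_one_right (Real.exp_pos _).le (pow_le_one₀ (norm_nonneg _) (hf1 t))
  have e0 : ∫ t in Set.Ioi (0 : ℝ), Real.exp (-z.im * t) = 1 / z.im := by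
    rw [integral_exp_mul_Ioi (by linarith)]; simp
  have h1 : ‖∫ t in Set.Ioi (0 : ℝ), Complex.exp (Complex.I * z * t) * f t‖ ≤ J := by
    refine (norm_integral_le_integral_norm _).trans_eq ?_
    simp only [norm_mul, norm_cexp_I_mul, hJ]
  -- `c` is the weighted mean of `‖f‖`; the inequality says that the weighted variance is nonnegative
  set c := z.im * J with hc
  have h2 : 0 ≤ ∫ t in Set.Ioi (0 : ℝ), Real.exp (-z.im * t) * (‖f t‖ - c) ^ 2 :=
    integral_nonneg fun t => by positivity
  have h3 : ∫ t in Set.Ioi (0 : ℝ), Real.exp (-z.im * t) * (‖f t‖ - c) ^ 2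
      = (∫ t in Set.Ioi (0 : ℝ), Real.exp (-z.im * t) * ‖f t‖ ^ 2) - 2 * c * J
        + c ^ 2 * (1 / z.im) := by
    have i3 : IntegrableOn (fun t : ℝ => Real.exp (-z.im * t) * ‖f t‖ ^ 2
        - 2 * c * (Real.exp (-z.im * t) * ‖f t‖)) (Set.Ioi 0) := i2.sub (i1.const_mul _)
    rw [← e0, hJ, ← integral_const_mul, ← integral_const_mul, ← integral_sub i2 (i1.const_mul _),
      ← integral_add i3 (i0.const_mul _)]
    congr 1 with t
    ring
  rw [h3, hc] at h2
  have h4 : (z.im * J) ^ 2 * (1 / z.im) = z.im * J ^ 2 := by field_simp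
  have h5 : z.im * J ^ 2 ≤ ∫ t in Set.Ioi (0 : ℝ), Real.exp (-z.im * t) * ‖f t‖ ^ 2 := by
    rw [h4] at h2; nlinarith
  have h6 : J ^ 2 ≤ 1 / z.im * ∫ t in Set.Ioi (0 : ℝ), Real.exp (-z.im * t) * ‖f t‖ ^ 2 := by
    rw [one_div, ← div_eq_inv_mul, le_div_iff₀ hz]; linarith
  exact (pow_le_pow_left₀ (norm_nonneg _) h1 2).trans h6

/-- The averaged probabilities dominate the Laplace transform at a single energy. Putting the full
decay rate `2 / T` into `Im z` makes Plancherel's formula unnecessary. -/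
theorem sq_norm_laplaceAmplitude_le {H : L2Z →L[ℂ] L2Z} (hH : IsSelfAdjoint H) {z : ℂ} {T : ℝ}
    (hT : 0 < T) (hz : z.im = 2 / T) (m n : ℤ) :
    2 / T ^ 2 * ‖laplaceAmplitude H (delta m) z n‖ ^ 2 ≤ timeAvgProb H (delta m) n T := by
  have hz' : 0 < z.im := by rw [hz]; positivity
  have h := sq_norm_integral_le (continuous_evolve_apply H (delta m) n)
    (norm_evolve_delta_apply_le hH m n) hz'
  unfold timeAvgProb laplaceAmplitude
  have e : ∀ t : ℝ, -2 * t / T = -z.im * t := fun t => by rw [hz]; ring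
  simp_rw [e, inner_delta_left]
  refine (mul_le_mul_of_nonneg_left h (by positivity)).trans_eq ?_
  rw [← mul_assoc, hz]
  congr 1
  field_simp

/-! ### Transfer matrices acting on complex solutions -/

theorem abs_apply_le_opNorm (A : Matrix (Fin 2) (Fin 2) ℝ) (i j : Fin 2) : |A i j| ≤ opNorm A := by
  have h1 := (Matrix.toEuclideanCLM (n := Fin 2) (𝕜 := ℝ) A).le_opNorm (EuclideanSpace.single j 1)
  have h2 := PiLp.norm_apply_le
    (Matrix.toEuclideanCLM (n := Fin 2) (𝕜 := ℝ) A (EuclideanSpace.single j 1)) i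
  have h3 : (Matrix.toEuclideanCLM (n := Fin 2) (𝕜 := ℝ) A (EuclideanSpace.single j 1)) i
      = A i j := by
    simp [Matrix.ofLp_toEuclideanCLM]
  rw [h3, Real.norm_eq_abs] at h2
  rw [PiLp.norm_single, norm_one, mul_one] at h1
  exact h2.trans h1

theorem det_stepMatrix (E x : ℝ) : (stepMatrix E x).det = 1 := by
  simp [stepMatrix, Matrix.det_fin_two]

theorem transferUp_sub_one (V : ℤ → ℝ) (E : ℝ) (j : ℤ) (k : ℕ) :
    transferUp V E (j - 1) (k + 1) = transferUp V E j k * stepMatrix E (V j) := by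
  induction k with
  | zero => simp [transferUp]
  | succ k ih =>
    rw [transferUp, ih, transferUp, mul_assoc]
    congr 3
    push_cast; ring

theorem transferMatrix_mul_stepMatrix (V : ℤ → ℝ) (E : ℝ) (m j : ℤ) :
    transferMatrix V E m j * stepMatrix E (V j) = transferMatrix V E m (j - 1) := by
  unfold transferMatrix
  rcases le_or_gt j m with h | h
  · rw [if_pos h, if_pos (by omega), ← transferUp_sub_one]
    congr 1; omega
  · have hdet : IsUnit (stepMatrix E (V j)).det := by simp [det_stepMatrix]
    obtain ⟨k, rfl⟩ : ∃ k : ℕ, j = m + k + 1 := ⟨(j - m - 1).toNat, by omega⟩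
    have e1 : (m + k + 1 - m).toNat = k + 1 := by omega
    have e2 : (m + k + 1 - 1 - m).toNat = k := by omega
    have e3 : m + ((k + 1 : ℕ) : ℤ) = m + k + 1 := by push_cast; ring
    rw [if_neg (by omega), e1, transferUp, e3, Matrix.mul_inv_rev, mul_assoc,
      Matrix.nonsing_inv_mul _ hdet, mul_one]
    split_ifs with h'
    · obtain rfl : k = 0 := by omega
      simp [transferUp]
    · rw [e2]

theorem transferMatrix_self (V : ℤ → ℝ) (E : ℝ) (n : ℤ) : transferMatrix V E n n = 1 := by
  simp [transferMatrix, transferUp]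

/-- The `ℓ¹` norm of `A (a, b)ᵀ` for a real matrix `A` and complex `a`, `b`. -/
noncomputable def actNorm (A : Matrix (Fin 2) (Fin 2) ℝ) (a b : ℂ) : ℝ :=
  ‖(A 0 0 : ℂ) * a + A 0 1 * b‖ + ‖(A 1 0 : ℂ) * a + A 1 1 * b‖

theorem actNorm_one (a b : ℂ) : actNorm 1 a b = ‖a‖ + ‖b‖ := by
  simp [actNorm]

theorem actNorm_le {A : Matrix (Fin 2) (Fin 2) ℝ} {κ : ℝ} (h : ∀ i j, |A i j| ≤ κ) (a b : ℂ) :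
    actNorm A a b ≤ 2 * κ * (‖a‖ + ‖b‖) := by
  have key : ∀ i, ‖(A i 0 : ℂ) * a + A i 1 * b‖ ≤ κ * (‖a‖ + ‖b‖) := by
    intro i
    refine (norm_add_le _ _).trans ?_
    rw [norm_mul, norm_mul, Complex.norm_real, Complex.norm_real, mul_add]
    exact add_le_add (mul_le_mul_of_nonneg_right (h i 0) (norm_nonneg _))
      (mul_le_mul_of_nonneg_right (h i 1) (norm_nonneg _))
  unfold actNorm
  linarith [key 0, key 1]

/-- One step of the variation of parameters: a solution of the perturbed recurrence at the complex
energy `z`, pulled back by the unperturbed transfer matrices at the real energy `E`, moves only by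
the size of the perturbation `z - y - (E - x)`. -/
theorem abs_actNorm_sub_le {A : Matrix (Fin 2) (Fin 2) ℝ} {κ E x y : ℝ} (h : ∀ i j, |A i j| ≤ κ)
    {a b c z : ℂ} (hu : a + c + y * b = z * b) :
    |actNorm A a b - actNorm (A * stepMatrix E x) b c| ≤ 2 * κ * ‖z - y - (E - x)‖ * ‖b‖ := by
  have key : ∀ i, |‖(A i 0 : ℂ) * a + A i 1 * b‖
      - ‖((A * stepMatrix E x) i 0 : ℂ) * b + (A * stepMatrix E x) i 1 * c‖|
      ≤ κ * ‖z - y - (E - x)‖ * ‖b‖ := by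
    intro i
    refine (abs_norm_sub_norm_le _ _).trans ?_
    have e : (A i 0 : ℂ) * a + A i 1 * b
        - (((A * stepMatrix E x) i 0 : ℂ) * b + (A * stepMatrix E x) i 1 * c)
        = A i 0 * (z - y - (E - x)) * b := by
      simp only [Matrix.mul_apply, Fin.sum_univ_two, stepMatrix, Matrix.of_apply,
        Matrix.cons_val_zero, Matrix.cons_val_one, Matrix.cons_val', Matrix.cons_val_fin_one]
      push_cast
      linear_combination (A i 0 : ℂ) * hu
    rw [e, norm_mul, norm_mul, Complex.norm_real]
    gcongr
    exact h i 0
  have h0 := key 0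
  have h1 := key 1
  unfold actNorm
  rw [abs_le] at *
  constructor <;> linarith [h0.1, h0.2, h1.1, h1.2]

/-! ### Discrete Grönwall inequality and perturbation of the transfer matrices -/

/-- A discrete Grönwall inequality adapted to the variation of parameters: `y k i` is the pullback
to site `k` of the value at site `i`. -/
theorem le_mul_exp_of_pullback {x b : ℕ → ℝ} {y : ℕ → ℕ → ℝ} {A : ℝ} {N : ℕ} (hA : 0 ≤ A)
    (hb : ∀ i, 0 ≤ b i) (h0 : ∀ k ≤ N, y k 0 ≤ A)
    (hs : ∀ k ≤ N, ∀ i < k, y k (i + 1) ≤ y k i + b i * x i) (hx : ∀ k ≤ N, x k ≤ y k k) :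
    x N ≤ A * Real.exp (∑ i ∈ Finset.range N, b i) := by
  have h1 : ∀ k ≤ N, ∀ l ≤ k, y k l ≤ A + ∑ i ∈ Finset.range l, b i * x i := by
    intro k hk l
    induction l with
    | zero => intro _; simpa using h0 k hk
    | succ l ih =>
      intro hl
      rw [Finset.sum_range_succ]
      linarith [ih (by omega), hs k hk l (by omega)]
  have h2 : ∀ k ≤ N, A + ∑ i ∈ Finset.range k, b i * x i
      ≤ A * Real.exp (∑ i ∈ Finset.range k, b i) := by
    intro k
    induction k with
    | zero => simp
    | succ k ih =>
      intro hk
      have hxk := (hx k (by omega)).trans (h1 k (by omega) k le_rfl)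
      rw [Finset.sum_range_succ, Finset.sum_range_succ, Real.exp_add]
      calc A + (∑ i ∈ Finset.range k, b i * x i + b k * x k)
          ≤ (A + ∑ i ∈ Finset.range k, b i * x i) * (b k + 1) := by
            linarith [mul_le_mul_of_nonneg_left hxk (hb k)]
        _ ≤ A * Real.exp (∑ i ∈ Finset.range k, b i) * Real.exp (b k) := by
            have h4 : 0 ≤ b k + 1 := by linarith [hb k]
            gcongr
            · exact ih (by omega)
            · exact Real.add_one_le_exp _
        _ = _ := by ring
  exact (hx N le_rfl).trans ((h1 N le_rfl N le_rfl).trans (h2 N le_rfl))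

/-- The transfer matrices of `Δ + V` at energy `E` grow at most like `K * d ^ α` on each half-line,
entrywise, where `d` is the distance of the two sites (increased by one to include `d = 0`). -/
def HasPowerBound (V : ℤ → ℝ) (E K α : ℝ) : Prop :=
  ∀ n m : ℤ, 0 ≤ n * m → ∀ i j, |transferMatrix V E n m i j| ≤ K * ((n - m).natAbs + 1 : ℝ) ^ α

section Propagation

variable {V U : ℤ → ℝ} {E K α : ℝ} {z : ℂ} {u : ℤ → ℂ} {g : ℕ → ℝ}

/-- Propagation from the site `n > 0` back to the site `1`. -/
theorem norm_right_le (hα : 0 ≤ α) (hK : 0 ≤ K) (hT : HasPowerBound V E K α)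
    (hg : ∀ j : ℤ, 2 * K * (j.natAbs + 1 : ℝ) ^ α * ‖z - U j - (E - V j)‖ ≤ g j.natAbs)
    (hu : ∀ j : ℤ, 2 ≤ j → u (j + 1) + u (j - 1) + U j * u j = z * u j) (n : ℕ) (hn : 1 ≤ n) :
    ‖u 2‖ + ‖u 1‖ ≤ 2 * K * (n + 1 : ℝ) ^ α * (‖u (n + 1)‖ + ‖u n‖)
      * Real.exp (∑ i ∈ Finset.range (n + 1), g i) := by
  have hg0 : ∀ k : ℕ, 0 ≤ g k := fun k => le_trans (by positivity) (hg k)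
  have h := le_mul_exp_of_pullback (N := n - 1)
    (x := fun i => ‖u (n - i + 1)‖ + ‖u (n - i)‖) (b := fun i => g (n - i))
    (y := fun k i => actNorm (transferMatrix V E (n - k) (n - i)) (u (n - i + 1)) (u (n - i)))
    (A := 2 * K * (n + 1 : ℝ) ^ α * (‖u (n + 1)‖ + ‖u n‖)) (by positivity) (fun i => hg0 _)
    ?_ ?_ ?_
  · rw [show ((n : ℤ) - ((n - 1 : ℕ) : ℤ)) = 1 by omega] at h
    refine h.trans ?_
    gcongr 2 * K * (n + 1 : ℝ) ^ α * (‖u (n + 1)‖ + ‖u n‖) * Real.exp ?_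
    calc ∑ i ∈ Finset.range (n - 1), g (n - i) ≤ ∑ i ∈ Finset.range (n + 1), g (n - i) :=
          Finset.sum_le_sum_of_subset_of_nonneg (Finset.range_mono (by omega)) fun _ _ _ => hg0 _
      _ = ∑ i ∈ Finset.range (n + 1), g i := Finset.sum_range_reflect g (n + 1)
  · intro k hk
    simp only [Nat.cast_zero, sub_zero]
    have h1 := actNorm_le (hT (n - k) n (mul_nonneg (by omega) (by omega))) (u (n + 1)) (u n)
    refine h1.trans ?_
    rw [show ((n : ℤ) - k - n).natAbs = k by omega, ← mul_assoc]
    gcongr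
    exact_mod_cast (by omega : k ≤ n)
  · intro k hk i hi
    have h1 := abs_actNorm_sub_le (E := E) (x := V (n - i))
      (hT (n - k) (n - i) (mul_nonneg (by omega) (by omega)))
      (hu (n - i) (by omega))
    rw [transferMatrix_mul_stepMatrix] at h1
    have h2 := (abs_le.1 h1).1
    have e : (n : ℤ) - ((i + 1 : ℕ) : ℤ) = n - i - 1 := by push_cast; ring
    simp only [e, sub_add_cancel]
    have h3 := hg (n - i)
    rw [show ((n : ℤ) - i).natAbs = n - i by omega] at h3
    have h4 : 2 * (K * ((((n : ℤ) - k - (n - i)).natAbs : ℝ) + 1) ^ α)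
        * ‖z - U (n - i) - (E - V (n - i))‖ * ‖u (n - i)‖
        ≤ g (n - i) * (‖u (n - i + 1)‖ + ‖u (n - i)‖) := by
      refine mul_le_mul (le_trans ?_ h3) (by linarith [norm_nonneg (u (n - i + 1))])
        (norm_nonneg _) (hg0 _)
      rw [← mul_assoc]
      gcongr
      omega
    linarith
  · intro k hk
    simp only [transferMatrix_self, actNorm_one]
    exact le_rfl

/-- Propagation from the site `-n < 0` forward to the site `0`. -/
theorem norm_left_le (hα : 0 ≤ α) (hK : 0 ≤ K) (hT : HasPowerBound V E K α)
    (hg : ∀ j : ℤ, 2 * K * (j.natAbs + 1 : ℝ) ^ α * ‖z - U j - (E - V j)‖ ≤ g j.natAbs)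
    (hu : ∀ j : ℤ, j ≤ 0 → u (j + 1) + u (j - 1) + U j * u j = z * u j) (n : ℕ) :
    ‖u 1‖ + ‖u 0‖ ≤ 2 * K * (n + 1 : ℝ) ^ α * (‖u (-n + 1)‖ + ‖u (-n)‖)
      * Real.exp (∑ i ∈ Finset.range (n + 1), g i) := by
  have hg0 : ∀ k : ℕ, 0 ≤ g k := fun k => le_trans (by positivity) (hg k)
  have h := le_mul_exp_of_pullback (N := n)
    (x := fun i => ‖u (-n + i + 1)‖ + ‖u (-n + i)‖) (b := fun i => g (n - 1 - i))
    (y := fun k i => actNorm (transferMatrix V E (-n + k) (-n + i)) (u (-n + i + 1)) (u (-n + i)))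
    (A := 2 * K * (n + 1 : ℝ) ^ α * (‖u (-n + 1)‖ + ‖u (-n)‖)) (by positivity) (fun i => hg0 _)
    ?_ ?_ ?_
  · rw [show (-(n : ℤ) + n) = 0 by omega] at h
    refine h.trans ?_
    gcongr 2 * K * (n + 1 : ℝ) ^ α * (‖u (-n + 1)‖ + ‖u (-n)‖) * Real.exp ?_
    rw [Finset.sum_range_reflect g n]
    exact Finset.sum_le_sum_of_subset_of_nonneg (Finset.range_mono (by omega)) fun _ _ _ => hg0 _
  · intro k hk
    simp only [Nat.cast_zero, add_zero]
    have h1 := actNorm_le (hT (-n + k) (-n) (mul_nonneg_of_nonpos_of_nonpos (by omega) (by omega)))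
      (u (-n + 1)) (u (-n))
    refine h1.trans ?_
    rw [show (-(n : ℤ) + k - -n).natAbs = k by omega, ← mul_assoc]
    gcongr
  · intro k hk i hi
    have h1 := abs_actNorm_sub_le (E := E) (x := V (-n + i + 1))
      (hT (-n + k) (-n + i + 1) (mul_nonneg_of_nonpos_of_nonpos (by omega) (by omega)))
      (hu (-n + i + 1) (by omega))
    rw [transferMatrix_mul_stepMatrix] at h1
    have h2 := (abs_le.1 h1).2
    have e : -(n : ℤ) + ((i + 1 : ℕ) : ℤ) = -n + i + 1 := by push_cast; ring
    simp only [e]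
    rw [add_sub_cancel_right] at h2
    have h3 := hg (-n + i + 1)
    rw [show (-(n : ℤ) + i + 1).natAbs = n - 1 - i by omega] at h3
    have h4 : 2 * (K * (((-(n : ℤ) + k - (-n + i + 1)).natAbs : ℝ) + 1) ^ α)
        * ‖z - U (-n + i + 1) - (E - V (-n + i + 1))‖ * ‖u (-n + i + 1)‖
        ≤ g (n - 1 - i) * (‖u (-n + i + 1)‖ + ‖u (-n + i)‖) := by
      refine mul_le_mul (le_trans ?_ h3) (by linarith [norm_nonneg (u (-n + i))])
        (norm_nonneg _) (hg0 _)
      rw [← mul_assoc]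
      gcongr
      omega
    linarith
  · intro k hk
    simp only [transferMatrix_self, actNorm_one]
    exact le_rfl

end Propagation

/-! ### Consequences of the hypotheses on the potentials -/

theorem det_transferMatrix_zero (V : ℤ → ℝ) (E : ℝ) (k : ℕ) : (transferMatrix V E k 0).det = 1 := by
  rw [transferMatrix, if_pos (by omega)]
  exact det_transferUp _ _ _ _

theorem half_le_opNorm {A : Matrix (Fin 2) (Fin 2) ℝ} (h : A.det = 1) : 1 / 2 ≤ opNorm A := by
  rw [Matrix.det_fin_two] at h
  have h0 : 0 ≤ opNorm A := norm_nonneg _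
  have key : ∀ i j k l, |A i j * A k l| ≤ opNorm A ^ 2 := by
    intro i j k l
    rw [abs_mul, sq]
    exact mul_le_mul (abs_apply_le_opNorm A i j) (abs_apply_le_opNorm A k l) (abs_nonneg _) h0
  have h1 := (abs_le.1 (key 0 0 1 1)).2
  have h2 := (abs_le.1 (key 0 1 1 0)).1
  nlinarith

/-- A power bound on matrices of determinant one cannot have a negative exponent. -/
theorem nonneg_exponent {V : ℤ → ℝ} {E α C : ℝ}
    (hT : ∀ n m : ℤ, n ≠ m → 0 ≤ n * m →
      opNorm (transferMatrix V E n m) ≤ C * |(n : ℝ) - (m : ℝ)| ^ α) : 0 ≤ α := by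
  by_contra! hα
  have h1 : Tendsto (fun k : ℕ => C * (k : ℝ) ^ α) atTop (𝓝 (C * 0)) := by
    have h := (tendsto_rpow_neg_atTop (y := -α) (by linarith)).comp tendsto_natCast_atTop_atTop
    simp only [neg_neg] at h
    exact h.const_mul C
  rw [mul_zero] at h1
  have h2 : (1 / 2 : ℝ) ≤ 0 := by
    refine ge_of_tendsto h1 ?_
    filter_upwards [eventually_ge_atTop 1] with k hk
    have h3 := hT k 0 (by omega) (by simp)
    have h4 := half_le_opNorm (det_transferMatrix_zero V E k)
    simp only [Int.cast_natCast, Int.cast_zero, sub_zero, Nat.abs_cast] at h3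
    exact h4.trans h3
  norm_num at h2

theorem hasPowerBound_of_opNorm_le {V : ℤ → ℝ} {E α C : ℝ} (hα : 0 ≤ α)
    (hT : ∀ n m : ℤ, n ≠ m → 0 ≤ n * m →
      opNorm (transferMatrix V E n m) ≤ C * |(n : ℝ) - (m : ℝ)| ^ α) :
    HasPowerBound V E (max C 1) α := by
  intro n m hnm i j
  rcases eq_or_ne n m with rfl | hne
  · rw [transferMatrix_self]
    simp only [sub_self, Int.natAbs_zero, Nat.cast_zero, zero_add, Real.one_rpow, mul_one]
    refine le_trans ?_ (le_max_right _ _)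
    rcases eq_or_ne i j with rfl | h
    · simp
    · simp [Matrix.one_apply_ne h]
  · refine (abs_apply_le_opNorm _ i j).trans ((hT n m hne hnm).trans ?_)
    have e : |(n : ℝ) - m| = ((n - m).natAbs : ℝ) := by
      rw [Nat.cast_natAbs]; push_cast; rfl
    rw [e]
    gcongr
    · exact le_max_left _ _
    · linarith

/-- The bound on two neighbouring sites controls the potential. -/
theorem isBddPotential_of_opNorm_le {V : ℤ → ℝ} {E α C : ℝ}
    (hT : ∀ n m : ℤ, n ≠ m → 0 ≤ n * m →
      opNorm (transferMatrix V E n m) ≤ C * |(n : ℝ) - (m : ℝ)| ^ α) : IsBddPotential V := by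
  refine ⟨C + |E|, fun n => ?_⟩
  have h1 := hT n (n - 1) (by omega) (by nlinarith [Int.le_self_sq n, sq n])
  have h2 := abs_apply_le_opNorm (transferMatrix V E n (n - 1)) 0 0
  rw [← transferMatrix_mul_stepMatrix, transferMatrix_self, one_mul] at h1 h2
  have e : |(n : ℝ) - ((n - 1 : ℤ) : ℝ)| = 1 := by push_cast; simp
  rw [e, Real.one_rpow, mul_one] at h1
  have h3 : |E - V n| ≤ C := by simpa [stepMatrix] using h2.trans h1
  rw [abs_le] at h3
  rw [abs_le]
  constructor <;> linarith [abs_le.1 (le_refl |E|), neg_abs_le E, le_abs_self E]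

/-- Decay of `W` in a form which includes the site `0`. -/
theorem exists_decay_bound {W : ℤ → ℝ} {α ε C : ℝ} (hα : 0 ≤ α) (hε : 0 < ε)
    (hW : ∀ n : ℤ, n ≠ 0 → |W n| ≤ C * |(n : ℝ)| ^ (-1 - 2 * α - ε)) :
    ∃ D : ℝ, 0 ≤ D ∧ ∀ n : ℤ, |W n| ≤ D * (n.natAbs + 1 : ℝ) ^ (-1 - α - ε) := by
  have hC : 0 ≤ C := by
    have h := (abs_nonneg _).trans (hW 1 one_ne_zero)
    simpa using h
  refine ⟨max |W 0| (C * 2 ^ (1 + α + ε)), (abs_nonneg _).trans (le_max_left _ _), fun n => ?_⟩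
  rcases eq_or_ne n 0 with rfl | hn
  · simp
  · have e : |(n : ℝ)| = (n.natAbs : ℝ) := by rw [Nat.cast_natAbs]; push_cast; rfl
    have h1 : (1 : ℝ) ≤ n.natAbs := by exact_mod_cast Int.natAbs_pos.2 hn
    refine (hW n hn).trans ?_
    rw [e]
    calc C * (n.natAbs : ℝ) ^ (-1 - 2 * α - ε) ≤ C * (n.natAbs : ℝ) ^ (-1 - α - ε) := by
          gcongr 1
          exact Real.rpow_le_rpow_of_exponent_le h1 (by linarith)
      _ ≤ C * ((n.natAbs + 1 : ℝ) / 2) ^ (-1 - α - ε) := by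
          gcongr 1
          exact Real.rpow_le_rpow_of_nonpos (by positivity) (by linarith) (by linarith)
      _ = C * 2 ^ (1 + α + ε) * (n.natAbs + 1 : ℝ) ^ (-1 - α - ε) := by
          rw [Real.div_rpow (by positivity) (by norm_num), show -1 - α - ε = -(1 + α + ε) by ring,
            Real.rpow_neg (by norm_num : (0 : ℝ) ≤ 2), div_inv_eq_mul]
          ring
      _ ≤ _ := by
          gcongr
          exact le_max_right _ _

theorem isBddPotential_of_decay {W : ℤ → ℝ} {D q : ℝ} (hD : 0 ≤ D) (hq : q ≤ 0)
    (hW : ∀ n : ℤ, |W n| ≤ D * (n.natAbs + 1 : ℝ) ^ q) : IsBddPotential W := by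
  refine ⟨D, fun n => (hW n).trans (mul_le_of_le_one_right hD ?_)⟩
  exact Real.rpow_le_one_of_one_le_of_nonpos (by linarith [Nat.cast_nonneg (α := ℝ) n.natAbs]) hq

/-! ### Lower bound on the Laplace transform -/

/-- A solution with a unit source at the site `1` cannot be small on both sides: at distance at most
`(B T)^(1/(1+α))` it is at least of order `n ^ (-α)` at `n` or at `-n`. -/
theorem exists_lower_bound {V W : ℤ → ℝ} {E K α ε D : ℝ} (hα : 0 ≤ α) (hε : 0 < ε) (hK : 1 ≤ K)
    (hD : 0 ≤ D) (hT : HasPowerBound V E K α)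
    (hW : ∀ n : ℤ, |W n| ≤ D * (n.natAbs + 1 : ℝ) ^ (-1 - α - ε)) (B : ℝ) :
    ∃ c : ℝ, 0 < c ∧ ∀ T : ℝ, 1 ≤ T → ∀ z : ℂ, z = E + (2 / T : ℝ) * Complex.I → ∀ u : ℤ → ℂ,
      (∀ j : ℤ, u (j - 1) + u (j + 1) + ((V + W) j : ℝ) * u j
        = z * u j - Complex.I * delta 1 j) →
      ∀ n : ℕ, 1 ≤ n → (n + 1 : ℝ) ^ (1 + α) ≤ B * T →
        c ≤ (n + 1 : ℝ) ^ α * (‖u (n + 1)‖ + ‖u n‖ + (‖u (-n + 1)‖ + ‖u (-n)‖)) := by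
  have hsum : Summable fun m : ℕ => (m + 1 : ℝ) ^ (-1 - ε) := by
    have h := (summable_nat_add_iff 1).2 (Real.summable_nat_rpow.2 (by linarith : -1 - ε < -1))
    simpa using h
  set Z := ∑' m : ℕ, (m + 1 : ℝ) ^ (-1 - ε) with hZ
  set L := Real.exp (2 * K * (D * Z + 2 * B)) with hL
  set R := 1 + |(V + W) 1| + |E| + 2 with hR
  have hR0 : 0 < R := by positivity
  refine ⟨1 / (R * (2 * K * L)), by positivity, fun T hT1 z hz u hu n hn hnT => ?_⟩
  have hT0 : 0 < T := by linarith
  have hhom : ∀ j : ℤ, j ≠ 1 → u (j + 1) + u (j - 1) + ((V + W) j : ℝ) * u j = z * u j := by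
    intro j hj
    have h := hu j
    have hd : delta 1 j = 0 := by rw [delta, lp.single_apply_ne _ _ _ hj]
    rw [hd, mul_zero, sub_zero] at h
    rw [← h]; ring
  have hsrc : 1 ≤ R * (‖u 2‖ + ‖u 1‖ + (‖u 1‖ + ‖u 0‖)) := by
    have h := hu 1
    have hd : delta 1 1 = 1 := by rw [delta, lp.single_apply_self]
    rw [hd, mul_one] at h
    norm_num only at h
    have h1 : -Complex.I = u 0 + u 2 + (((V + W) 1 : ℝ) - z) * u 1 := by
      linear_combination -h
    have h2 : (1 : ℝ) = ‖-Complex.I‖ := by simp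
    have hz2 : ‖z‖ ≤ |E| + 2 := by
      rw [hz]
      refine (norm_add_le _ _).trans ?_
      rw [norm_mul, Complex.norm_I, mul_one, Complex.norm_real, Complex.norm_real, Real.norm_eq_abs,
        Real.norm_of_nonneg (by positivity)]
      have : 2 / T ≤ 2 := div_le_self (by norm_num) hT1
      linarith
    have h3 : ‖(((V + W) 1 : ℝ) - z : ℂ)‖ ≤ |(V + W) 1| + (|E| + 2) := by
      refine (norm_sub_le _ _).trans ?_
      rw [Complex.norm_real, Real.norm_eq_abs]
      linarith
    rw [h2, h1]
    refine (norm_add₃_le).trans ?_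
    rw [norm_mul]
    have h4 := mul_le_mul_of_nonneg_right h3 (norm_nonneg (u 1))
    have h5 : 1 ≤ R := by rw [hR]; linarith [abs_nonneg ((V + W) 1), abs_nonneg E]
    have h6 : |(V + W) 1| + (|E| + 2) ≤ R := by rw [hR]; linarith
    nlinarith [norm_nonneg (u 0), norm_nonneg (u 1), norm_nonneg (u 2)]
  set g : ℕ → ℝ := fun m => 2 * K * (D * (m + 1 : ℝ) ^ (-1 - ε) + 2 / T * (m + 1 : ℝ) ^ α) with hgdef
  have hg : ∀ j : ℤ, 2 * K * (j.natAbs + 1 : ℝ) ^ α * ‖z - ((V + W) j : ℝ) - (E - V j)‖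
      ≤ g j.natAbs := by
    intro j
    have e : z - ((V + W) j : ℝ) - (E - V j) = (2 / T : ℝ) * Complex.I - W j := by
      rw [hz, Pi.add_apply]; push_cast; ring
    have h1 : ‖z - ((V + W) j : ℝ) - (E - V j)‖
        ≤ 2 / T + D * (j.natAbs + 1 : ℝ) ^ (-1 - α - ε) := by
      rw [e]
      refine (norm_sub_le _ _).trans ?_
      rw [norm_mul, Complex.norm_I, mul_one, Complex.norm_real, Complex.norm_real,
        Real.norm_of_nonneg (by positivity : 0 ≤ 2 / T), Real.norm_eq_abs]
      linarith [hW j]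
    have h2 : (j.natAbs + 1 : ℝ) ^ α * (j.natAbs + 1 : ℝ) ^ (-1 - α - ε)
        = (j.natAbs + 1 : ℝ) ^ (-1 - ε) := by
      rw [← Real.rpow_add (by positivity)]; congr 1; ring
    calc _ ≤ 2 * K * (j.natAbs + 1 : ℝ) ^ α
          * (2 / T + D * (j.natAbs + 1 : ℝ) ^ (-1 - α - ε)) := by gcongr
      _ = _ := by rw [hgdef]; simp only; rw [← h2]; ring
  have hgsum : ∑ i ∈ Finset.range (n + 1), g i ≤ 2 * K * (D * Z + 2 * B) := by
    have h1 : ∑ i ∈ Finset.range (n + 1), (i + 1 : ℝ) ^ (-1 - ε) ≤ Z :=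
      hsum.sum_le_tsum _ fun _ _ => by positivity
    have h2 : ∑ i ∈ Finset.range (n + 1), (i + 1 : ℝ) ^ α ≤ B * T := by
      have h3 : ∀ i ∈ Finset.range (n + 1), (i + 1 : ℝ) ^ α ≤ (n + 1 : ℝ) ^ α := by
        intro i hi
        have : (i : ℝ) ≤ n := by exact_mod_cast Nat.lt_succ_iff.1 (Finset.mem_range.1 hi)
        gcongr
      refine (Finset.sum_le_card_nsmul _ _ _ h3).trans (le_trans (le_of_eq ?_) hnT)
      rw [Real.rpow_add (by positivity), Real.rpow_one, Finset.card_range, nsmul_eq_mul]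
      push_cast; ring
    have h4 : 2 / T * (B * T) = 2 * B := by field_simp
    rw [hgdef, ← Finset.mul_sum, Finset.sum_add_distrib, ← Finset.mul_sum, ← Finset.mul_sum, ← h4]
    gcongr
  have hexp : Real.exp (∑ i ∈ Finset.range (n + 1), g i) ≤ L := Real.exp_le_exp.2 hgsum
  have hr := norm_right_le (U := V + W) hα (by linarith) hT hg
    (fun j hj => hhom j (by omega)) n hn
  have hl := norm_left_le (U := V + W) hα (by linarith) hT hg (fun j hj => hhom j (by omega)) n
  have hr' : ‖u 2‖ + ‖u 1‖ ≤ 2 * K * (n + 1 : ℝ) ^ α * (‖u (n + 1)‖ + ‖u n‖) * L :=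
    hr.trans (by gcongr)
  have hl' : ‖u 1‖ + ‖u 0‖ ≤ 2 * K * (n + 1 : ℝ) ^ α * (‖u (-n + 1)‖ + ‖u (-n)‖) * L :=
    hl.trans (by gcongr)
  rw [div_le_iff₀ (by positivity)]
  calc 1 ≤ R * (‖u 2‖ + ‖u 1‖ + (‖u 1‖ + ‖u 0‖)) := hsrc
    _ ≤ R * (2 * K * (n + 1 : ℝ) ^ α * (‖u (n + 1)‖ + ‖u n‖) * L
        + 2 * K * (n + 1 : ℝ) ^ α * (‖u (-n + 1)‖ + ‖u (-n)‖) * L) := by gcongr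
    _ = _ := by ring

/-! ### From pointwise bounds to moments -/

/-- Sites `n + 1`, `n`, `-n + 1`, `-n` with `M < n ≤ 2 * M` all have modulus at least `M`, so mass at
one of them for every such `n` bounds the moment from below. -/
theorem le_moment_of_pointwise {H : L2Z →L[ℂ] L2Z} {ψ : L2Z} {p T b : ℝ} {M : ℕ} (hp : 0 < p)
    {v : ℤ → ℝ} (hv0 : ∀ n, 0 ≤ v n) (hv : ∀ n, v n ≤ timeAvgProb H ψ n T)
    (hb : ∀ n : ℕ, M + 1 ≤ n → n ≤ 2 * M → b ≤ v (n + 1) + v n + (v (-n + 1) + v (-n))) :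
    ENNReal.ofReal (M * ((M : ℝ) ^ p * b) / 4) ≤ moment H ψ p T := by
  set F : ℤ → ENNReal := fun n => ENNReal.ofReal (|(n : ℝ)| ^ p * timeAvgProb H ψ n T) with hF
  have hFv : ∀ n : ℤ, M ≤ n.natAbs → ENNReal.ofReal ((M : ℝ) ^ p * v n) ≤ F n := by
    intro n hn
    refine ENNReal.ofReal_le_ofReal ?_
    have h1 : (M : ℝ) ≤ |(n : ℝ)| := by
      rw [← Int.cast_abs, ← Nat.cast_natAbs]
      exact_mod_cast hn
    have h2 := hv n
    have h3 := hv0 n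
    gcongr
  have hsum : ∀ f : ℕ → ℤ, Function.Injective f →
      ∑ n ∈ Finset.Icc (M + 1) (2 * M), F (f n) ≤ moment H ψ p T := fun f hf =>
    (ENNReal.sum_le_tsum _).trans (ENNReal.tsum_comp_le_tsum_of_injective hf F)
  have h4 : ∑ n ∈ Finset.Icc (M + 1) (2 * M), ENNReal.ofReal ((M : ℝ) ^ p * b)
      ≤ 4 * moment H ψ p T := by
    calc ∑ n ∈ Finset.Icc (M + 1) (2 * M), ENNReal.ofReal ((M : ℝ) ^ p * b)
        ≤ ∑ n ∈ Finset.Icc (M + 1) (2 * M), (F ((n : ℤ) + 1) + F (n : ℤ)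
            + (F (-(n : ℤ) + 1) + F (-(n : ℤ)))) := by
          refine Finset.sum_le_sum fun n hn => ?_
          rw [Finset.mem_Icc] at hn
          have hM : 0 ≤ (M : ℝ) ^ p := by positivity
          calc ENNReal.ofReal ((M : ℝ) ^ p * b)
              ≤ ENNReal.ofReal ((M : ℝ) ^ p * v (n + 1) + (M : ℝ) ^ p * v n
                + ((M : ℝ) ^ p * v (-n + 1) + (M : ℝ) ^ p * v (-n))) := by
                refine ENNReal.ofReal_le_ofReal ?_
                rw [← mul_add, ← mul_add, ← mul_add]
                exact mul_le_mul_of_nonneg_left (hb n hn.1 hn.2) hM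
            _ ≤ _ := by
                refine ENNReal.ofReal_add_le.trans ?_
                refine add_le_add (ENNReal.ofReal_add_le.trans ?_)
                  (ENNReal.ofReal_add_le.trans ?_)
                · exact add_le_add (hFv _ (by omega)) (hFv _ (by omega))
                · exact add_le_add (hFv _ (by omega)) (hFv _ (by omega))
      _ ≤ moment H ψ p T + moment H ψ p T + (moment H ψ p T + moment H ψ p T) := by
          rw [Finset.sum_add_distrib, Finset.sum_add_distrib, Finset.sum_add_distrib]
          gcongr
          · exact hsum (fun n => (n : ℤ) + 1) fun a b h => by simpa using h
          · exact hsum (fun n => (n : ℤ)) fun a b h => by simpa using h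
          · exact hsum (fun n => -(n : ℤ) + 1) fun a b h => by simpa using h
          · exact hsum (fun n => -(n : ℤ)) fun a b h => by simpa using h
      _ = 4 * moment H ψ p T := by ring
  rw [Finset.sum_const, Nat.card_Icc, show 2 * M + 1 - (M + 1) = M by omega, nsmul_eq_mul,
    ← ENNReal.ofReal_natCast, ← ENNReal.ofReal_mul (by positivity)] at h4
  rw [ENNReal.ofReal_div_of_pos (by norm_num), ENNReal.ofReal_ofNat]
  exact ENNReal.div_le_of_le_mul' h4

/-- A power lower bound on the moment is a lower bound on its growth exponent. -/
theorem le_betaMinus {H : L2Z →L[ℂ] L2Z} {ψ : L2Z} {p c γ : ℝ} (hc : 0 < c)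
    (h : ∀ᶠ T : ℝ in atTop, ENNReal.ofReal (c * T ^ γ) ≤ moment H ψ p T) :
    (γ : EReal) ≤ betaMinus H ψ p := by
  have h1 : Tendsto (fun T : ℝ => (((Real.log c + γ * Real.log T) / Real.log T : ℝ) : EReal)) atTop
      (𝓝 (γ : EReal)) := by
    refine (continuous_coe_real_ereal.tendsto γ).comp ?_
    have h2 : Tendsto (fun T : ℝ => Real.log c / Real.log T + γ) atTop (𝓝 (0 + γ)) :=
      (Real.tendsto_log_atTop.const_div_atTop _).add_const γ
    rw [zero_add] at h2
    refine h2.congr' ?_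
    filter_upwards [eventually_gt_atTop 1] with T hT
    have := Real.log_pos hT
    field_simp
  rw [← h1.liminf_eq]
  unfold betaMinus
  refine liminf_le_liminf ?_
  filter_upwards [h, eventually_gt_atTop 1] with T hT hT1
  have hT0 : 0 < T := by linarith
  have h3 := ENNReal.log_le_log hT
  rw [ENNReal.log_ofReal_of_pos (by positivity), Real.log_mul hc.ne' (by positivity),
    Real.log_rpow hT0] at h3
  rw [EReal.coe_div]
  exact EReal.div_le_div_right_of_nonneg (by exact_mod_cast (Real.log_pos hT1).le) h3

/-- The moment is at least of order `T ^ ((p - 1 - 4 α) / (1 + α))`: evaluate the lower bound on the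
Laplace transform at the scale `M ∼ T ^ (1 / (1 + α))`, the largest one on which an energy shift of
size `2 / T` leaves the transfer matrices under control. -/
theorem exists_moment_lower_bound {V W : ℤ → ℝ} (hb : IsBddPotential (V + W)) {E K α ε D : ℝ}
    (hα : 0 ≤ α) (hε : 0 < ε) (hK : 1 ≤ K) (hD : 0 ≤ D) (hT : HasPowerBound V E K α)
    (hW : ∀ n : ℤ, |W n| ≤ D * (n.natAbs + 1 : ℝ) ^ (-1 - α - ε)) {p : ℝ} (hp : 0 < p) :
    ∃ c : ℝ, 0 < c ∧ ∀ T : ℝ, 1 ≤ T → ENNReal.ofReal (c * T ^ ((p - 1 - 4 * α) / (1 + α)))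
      ≤ moment (schrodingerOp (V + W) hb) (delta 1) p T := by
  -- the constant `3 ^ (1 + α)` covers the sites `n + 1 ≤ 2 * M + 1 ≤ 3 * L` with `L ^ (1 + α) = T`
  obtain ⟨c, hc, hlow⟩ := exists_lower_bound hα hε hK hD hT hW (3 ^ (1 + α))
  refine ⟨(1 / 2) ^ (1 + p) * (3 ^ (-α)) ^ 2 * c ^ 2 / 8, by positivity, fun T hT1 => ?_⟩
  have hT0 : 0 < T := by linarith
  set L : ℝ := T ^ (1 / (1 + α)) with hL
  have hL1 : 1 ≤ L := Real.one_le_rpow hT1 (by positivity)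
  have hL0 : 0 < L := by linarith
  have hLT : L ^ (1 + α) = T := by
    rw [hL, ← Real.rpow_mul hT0.le, one_div_mul_cancel (by positivity), Real.rpow_one]
  set M : ℕ := ⌊L⌋₊ with hM
  have hML : (M : ℝ) ≤ L := Nat.floor_le hL0.le
  have hM1 : 1 ≤ M := Nat.le_floor (by simpa using hL1)
  have hM1' : (1 : ℝ) ≤ M := by exact_mod_cast hM1
  have hM2 : 1 / 2 * L ≤ M := by
    have := Nat.lt_floor_add_one L
    linarith
  set z : ℂ := E + (2 / T : ℝ) * Complex.I with hz
  have hzim : z.im = 2 / T := by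
    simp [hz]
  have hzpos : 0 < z.im := by rw [hzim]; positivity
  set u := laplaceAmplitude (schrodingerOp (V + W) hb) (delta 1) z with hu
  have hlow' := hlow T hT1 z hz u (laplaceAmplitude_eq (V + W) hb hzpos)
  have hpt : ∀ n : ℕ, M + 1 ≤ n → n ≤ 2 * M →
      2 / T ^ 2 * ((c * (3 * L) ^ (-α)) ^ 2 / 4) ≤ 2 / T ^ 2 * ‖u (n + 1)‖ ^ 2
        + 2 / T ^ 2 * ‖u n‖ ^ 2 + (2 / T ^ 2 * ‖u (-n + 1)‖ ^ 2 + 2 / T ^ 2 * ‖u (-n)‖ ^ 2) := by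
    intro n hn1 hn2
    have hn3 : (n + 1 : ℝ) ≤ 3 * L := by
      have : (n : ℝ) ≤ 2 * M := by exact_mod_cast hn2
      linarith
    have h1 := hlow' n (by omega) (by
      rw [← hLT, ← Real.mul_rpow (by norm_num) hL0.le]
      gcongr)
    set s := ‖u (n + 1)‖ + ‖u n‖ + (‖u (-n + 1)‖ + ‖u (-n)‖) with hs
    have hs0 : 0 ≤ s := by positivity
    have h2 : c ≤ (3 * L) ^ α * s := h1.trans (by gcongr)
    have h3 : c * (3 * L) ^ (-α) ≤ s := by
      rw [Real.rpow_neg (by positivity), ← div_eq_mul_inv, div_le_iff₀ (by positivity)]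
      linarith
    have h4 : (c * (3 * L) ^ (-α)) ^ 2 ≤ s ^ 2 := pow_le_pow_left₀ (by positivity) h3 2
    have h5 : s ^ 2 / 4 ≤ ‖u (n + 1)‖ ^ 2 + ‖u n‖ ^ 2 + (‖u (-n + 1)‖ ^ 2 + ‖u (-n)‖ ^ 2) := by
      rw [hs]
      nlinarith [sq_nonneg (‖u (n + 1)‖ - ‖u n‖), sq_nonneg (‖u (-n + 1)‖ - ‖u (-n)‖),
        sq_nonneg (‖u (n + 1)‖ + ‖u n‖ - (‖u (-n + 1)‖ + ‖u (-n)‖))]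
    rw [← mul_add, ← mul_add, ← mul_add]
    gcongr
    linarith
  refine le_trans (ENNReal.ofReal_le_ofReal ?_) (le_moment_of_pointwise hp
    (fun n => by positivity) (fun n => sq_norm_laplaceAmplitude_le
      (isSelfAdjoint_schrodingerOp _ hb) hT0 hzim 1 n) hpt)
  have hTγ : T ^ ((p - 1 - 4 * α) / (1 + α)) = L ^ (1 + p) * (L ^ (-α)) ^ 2 / T ^ 2 := by
    rw [← hLT, ← Real.rpow_mul hL0.le, mul_div_cancel₀ _ (by positivity), ← Real.rpow_natCast,
      ← Real.rpow_natCast, ← Real.rpow_mul hL0.le, ← Real.rpow_mul hL0.le,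
      ← Real.rpow_add hL0, ← Real.rpow_sub hL0]
    congr 1; push_cast; ring
  calc (1 / 2) ^ (1 + p) * (3 ^ (-α)) ^ 2 * c ^ 2 / 8 * T ^ ((p - 1 - 4 * α) / (1 + α))
      = (1 / 2 * L) ^ (1 + p) * (2 / T ^ 2 * ((c * (3 * L) ^ (-α)) ^ 2 / 4)) / 4 := by
        rw [hTγ, Real.mul_rpow (by norm_num) hL0.le, Real.mul_rpow (by norm_num) hL0.le]
        ring
    _ ≤ (M : ℝ) ^ (1 + p) * (2 / T ^ 2 * ((c * (3 * L) ^ (-α)) ^ 2 / 4)) / 4 := by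
        gcongr
    _ = _ := by
        rw [Real.rpow_add (by linarith), Real.rpow_one]
        ring

end Schrodinger1D

theorem corollary3p2 (V W : ℤ → ℝ) (E₀ α ε C₁ C₂ : ℝ)
    (hT : ∀ n m : ℤ, n ≠ m → 0 ≤ n * m →
      Schrodinger1D.opNorm (Schrodinger1D.transferMatrix V E₀ n m) ≤ C₁ * |(n : ℝ) - (m : ℝ)| ^ α)
    (hε : 0 < ε)
    (hW : ∀ n : ℤ, n ≠ 0 → |W n| ≤ C₂ * |(n : ℝ)| ^ (-1 - 2 * α - ε)) :
    -- the hypotheses make `V + W` bounded, so that `Δ + V + W` is a bounded operator on `ℓ²(ℤ)`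
    ∃ hb : Schrodinger1D.IsBddPotential (V + W), ∀ p : ℝ, 0 < p →
      (((p - 1 - 4 * α) / (1 + α) : ℝ) : EReal) ≤
        Schrodinger1D.betaMinus (Schrodinger1D.schrodingerOp (V + W) hb) (Schrodinger1D.delta 1) p := by
  have hα := Schrodinger1D.nonneg_exponent hT
  obtain ⟨D, hD, hWD⟩ := Schrodinger1D.exists_decay_bound hα hε hW
  obtain ⟨A, hA⟩ := Schrodinger1D.isBddPotential_of_opNorm_le hT
  obtain ⟨B, hB⟩ := Schrodinger1D.isBddPotential_of_decay hD (by linarith) hWD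
  have hb : Schrodinger1D.IsBddPotential (V + W) :=
    ⟨A + B, fun n => (abs_add_le _ _).trans (add_le_add (hA n) (hB n))⟩
  refine ⟨hb, fun p hp => ?_⟩
  obtain ⟨c, hc, h⟩ := Schrodinger1D.exists_moment_lower_bound hb hα hε (le_max_right C₁ 1) hD
    (Schrodinger1D.hasPowerBound_of_opNorm_le hα hT) hWD hp
  exact Schrodinger1D.le_betaMinus hc ((Filter.eventually_ge_atTop 1).mono h)
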